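/- Let $\beta,\sigma>0$ and let $\lambda_\phi,\lambda_\psi,\lambda_z,\alpha\in\mathbb R$. Consider the closed-loop system formed by the three-state Moore–Greitzer model $$\dot\phi=\tfrac32\phi-\psi+\tfrac12\left[1-(1+\phi)^3\right]-3R(1+\phi),\qquad \dot\psi=\tfrac1{\beta^2}(\phi-u),\qquad \dot R=-\sigma R^2-\sigma R(2\phi+\phi^2),\qquad R(0)\ge 0,$$ and the nonlinear PI controller $$u=\phi-\beta^2\left\{\lambda_\phi\phi+\lambda_\psi\psi+\lambda_z z+\alpha\left[1-(1+\phi)^3\right]\right\},\qquad \dot z=-\phi .$$ Put $$\mathcal A=\begin{bmatrix}\tfrac32&-1&0\\ \lambda_\phi&\lambda_\psi&\lambda_z\\ -1&0&0\end{bmatrix},\qquad \mathcal B=\begin{bmatrix}\tfrac12\\ \alpha\\ 0\end{bmatrix},\qquad \mathcal C=[\,1,\,0,\,0\,],\qquad T(s)=\mathcal C(sI_3-\mathcal A)^{-1}\mathcal B,$$ and suppose that 1. the pair $(\mathcal C,\mathcal A)$ is observable, the pair $(\mathcal A,\mathcal B)$ is controllable, and $-\operatorname{Re}T(j\omega)-\tfrac34|T(j\omega)|^2\le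 0$ for every $\omega\ge0$ at which $T(j\omega)$ is defined, i.e. at which $j\omega I_3-\mathcal A$ is invertible; 2. the matrix $\mathcal A-\tfrac34\mathcal B\mathcal C$ is Hurwitz (all its eigenvalues have negative real part). Then every solution $(\phi,\psi,z,R)$ of the closed-loop system is bounded: if it is defined on a time interval $J\subseteq[0,\infty)$ with $0\in J$ (bounded or unbounded), then there is $M$ (which may depend on the solution) with $|\phi(t)|,|\psi(t)|,|z(t)|,|R(t)|\le M$ for all $t\in J$. In particular, no solution escapes to infinity in finite time. -/

import Mathlib

namespace MooreGreitzer

/-- The compressor characteristic `W(v) = 1 - (1 + v)³`. -/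
def W (v : ℝ) : ℝ := 1 - (1 + v) ^ 3

/-- `(φ, ψ, R)` solves, on the time interval `J` with initial time `0`, the three-state
Moore–Greitzer model with parameters `β`, `σ` and input `u`, and `R(0) ≥ 0`. -/
structure IsModelSolution (β σ : ℝ) (u φ ψ R : ℝ → ℝ) (J : Set ℝ) : Prop where
  deriv_phi : ∀ t ∈ J, HasDerivWithinAt φ
    (3 / 2 * φ t - ψ t + 1 / 2 * W (φ t) - 3 * R t * (1 + φ t)) J t
  deriv_psi : ∀ t ∈ J, HasDerivWithinAt ψ (1 / β ^ 2 * (φ t - u t)) J t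
  deriv_R : ∀ t ∈ J, HasDerivWithinAt R
    (-σ * R t ^ 2 - σ * R t * (2 * φ t + φ t ^ 2)) J t
  R_zero : 0 ≤ R 0

/-- On the time interval `J`, the input `u` is generated by the nonlinear PI controller with
gains `lphi`, `lpsi`, `lz`, `α` and internal state `z`. -/
structure IsControllerOutput (β lphi lpsi lz α : ℝ) (φ ψ z u : ℝ → ℝ) (J : Set ℝ) : Prop where
  feedback : ∀ t ∈ J,
    u t = φ t - β ^ 2 * (lphi * φ t + lpsi * ψ t + lz * z t + α * W (φ t))
  deriv_z : ∀ t ∈ J, HasDerivWithinAt z (-φ t) J t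

/-- State matrix of the linear part of the controlled surge subsystem, state `(φ, ψ, z)`. -/
noncomputable def matA (lphi lpsi lz : ℝ) : Matrix (Fin 3) (Fin 3) ℝ :=
  !![3 / 2, -1, 0; lphi, lpsi, lz; -1, 0, 0]

/-- Input matrix through which `W(φ)` enters. -/
noncomputable def matB (α : ℝ) : Matrix (Fin 3) (Fin 1) ℝ := !![1 / 2; α; 0]

/-- Output matrix, `v = φ`. -/
def matC : Matrix (Fin 1) (Fin 3) ℝ := !![1, 0, 0]

/-- Controllability of `(A, B)`: the matrix `[B, AB, …, Aⁿ⁻¹B]` has rank `n`. -/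
def IsControllable {n m : ℕ} (A : Matrix (Fin n) (Fin n) ℝ) (B : Matrix (Fin n) (Fin m) ℝ) :
    Prop :=
  (Matrix.of fun (i : Fin n) (p : Fin n × Fin m) => (A ^ (p.1 : ℕ) * B) i p.2).rank = n

/-- Observability of `(C, A)`: the matrix with block rows `C, CA, …, CAⁿ⁻¹` has rank `n`. -/
def IsObservable {n m : ℕ} (C : Matrix (Fin m) (Fin n) ℝ) (A : Matrix (Fin n) (Fin n) ℝ) :
    Prop :=
  (Matrix.of fun (p : Fin n × Fin m) (j : Fin n) => (C * A ^ (p.1 : ℕ)) p.2 j).rank = n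

/-- A real square matrix is Hurwitz if all its complex eigenvalues have negative real part. -/
def IsHurwitz {n : ℕ} (M : Matrix (Fin n) (Fin n) ℝ) : Prop :=
  ∀ s ∈ spectrum ℂ (M.map Complex.ofReal), s.re < 0

/-- The matrix `s I - A` over `ℂ`. -/
noncomputable def pencil {n : ℕ} (A : Matrix (Fin n) (Fin n) ℝ) (s : ℂ) :
    Matrix (Fin n) (Fin n) ℂ :=
  s • (1 : Matrix (Fin n) (Fin n) ℂ) - A.map Complex.ofReal

/-- The scalar transfer function `T(s) = C (s I - A)⁻¹ B`, meaningful when `s I - A` is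
invertible. -/
noncomputable def transfer {n : ℕ} (A : Matrix (Fin n) (Fin n) ℝ) (B : Matrix (Fin n) (Fin 1) ℝ)
    (C : Matrix (Fin 1) (Fin n) ℝ) (s : ℂ) : ℂ :=
  (C.map Complex.ofReal * (pencil A s)⁻¹ * B.map Complex.ofReal) 0 0

/-- The circle-criterion conditions on the controller parameters. The frequency inequality is
required at all `ω ≥ 0` at which `T(jω)` is defined. -/
structure CircleConditions (lphi lpsi lz α : ℝ) : Prop where
  observable : IsObservable matC (matA lphi lpsi lz)
  controllable : IsControllable (matA lphi lpsi lz) (matB α)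
  frequency : ∀ ω : ℝ, 0 ≤ ω →
    IsUnit (pencil (matA lphi lpsi lz) (Complex.I * (ω : ℂ))).det →
    -(transfer (matA lphi lpsi lz) (matB α) matC (Complex.I * (ω : ℂ))).re
      - 3 / 4 * ‖transfer (matA lphi lpsi lz) (matB α) matC (Complex.I * (ω : ℂ))‖ ^ 2 ≤ 0
  hurwitz : IsHurwitz (matA lphi lpsi lz - (3 / 4 : ℝ) • (matB α * matC))

end MooreGreitzer

/-!
The proof is an explicit Lyapunov argument. With `φ (W φ + 3/4 φ) = -φ² (φ + 3/2)²` the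
nonlinearity `w = W φ + 3/4 φ` is dissipative once the linear part is replaced by
`A - 3/4 B C`, whose transfer function is `s (s/2 + b) / p(s)` with `b = -(lpsi/2 + α)` and
`p(s) = s³ + p₂ s² + p₁ s + p₀` the characteristic polynomial. The circle conditions say exactly
what is needed of these numbers: the Hurwitz property gives `p₁, p₀ > 0`
(`CircleConditions.hurwitz_coeff_pos`), the frequency inequality gives `p₂ ≥ 2 b` and
`b p₁ ≥ p₀ / 2` (`CircleConditions.frequency_coeff_nonneg`), hence `b > 0`, and controllability
excludes a cancellation at `s = -2 b` (`CircleConditions.coupling_ne_zero`). Set `k = p₀ / (2 b)`,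
`c₁ = p₂ - 2 b`, `η = 2 α φ - ψ - k z` and `d = -3 R (1 + φ)`. The surge subsystem becomes
`φ' = -c₁ φ + k z + η + w/2 + d`, `z' = -φ`, `η' = D φ - 2 b η + 2 α d`, with `D ≠ 0` and
`D ≤ 2 b c₁`. The Kalman–Yakubovich–Popov certificate is then the diagonal form
`V = φ² + k z² + η² / |D|`: along solutions `V' ≤ -φ² (φ + 3/2)² + O(√V) |d|`
(`storage_rate_nonpos`).

Two obstacles remain: the dissipation does not see `z` and `η`, and the stall variable `R` enters
through `d`. The stall variable stays in `[0, R 0 + 2]` (`stall_mem_Icc`), and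
`R' = σ R (1 - R - (1 + φ)²)`, so a multiple of `R` of order `√V` pays for `d`. The cross term
`Q = -φ z + κ η²` satisfies `Q' ≤ -c V + E φ² - w z / 2 + O(√V) d` (`cross_rate_le`). At the level
`V ≈ N² = n⁸` consider `U = V + F n⁴ R + n⁻³ Q`. The cross term contributes `-c n⁵ / 2` to `U'`,
while everything not absorbed by `-φ² (φ + 3/2)²` is `O(n⁴)`; so `U' < 0` on the level set
`U = n⁸` for every large `n` (`lyapunov_rate_neg`, `exists_invariant_level`), the sublevel set is
invariant, and choosing `n` large for the given initial state bounds the solution.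
-/

open Set

namespace MooreGreitzer

/-! ### Barrier arguments on an interval starting at zero -/

/-- A function that starts below a barrier `B`, and grows more slowly than `B` whenever it touches
it, stays below `B`. The interval `J` may be open or closed on the right, or reduced to `{0}`. -/
theorem le_of_hasDerivWithinAt_lt {J : Set ℝ} (hJ : J.OrdConnected) (hJ0 : (0 : ℝ) ∈ J)
    (hJpos : J ⊆ Ici 0) {f f' B B' : ℝ → ℝ}
    (hf : ∀ t ∈ J, HasDerivWithinAt f (f' t) J t)
    (hB : ∀ t, HasDerivAt B (B' t) t) (h0 : f 0 ≤ B 0)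
    (hlt : ∀ t ∈ J, f t = B t → f' t < B' t) {T : ℝ} (hT : T ∈ J) : f T ≤ B T := by
  have hsub : Icc 0 T ⊆ J := hJ.out hJ0 hT
  refine image_le_of_deriv_right_lt_deriv_boundary (f := f) (f' := f') (a := 0) (b := T)
    (fun t ht => ((hf t (hsub ht)).mono hsub).continuousWithinAt) (fun t ht => ?_) h0 hB
    (fun t ht => hlt t (hsub (Ico_subset_Icc_self ht))) ⟨hJpos hT, le_rfl⟩
  refine (hf t (hsub (Ico_subset_Icc_self ht))).mono_of_mem_nhdsWithin ?_
  filter_upwards [Icc_mem_nhdsGE ht.2] with x hx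
  exact hsub ⟨ht.1.trans hx.1, hx.2⟩

/-- A solution of a linear equation `R' = R g` with nonnegative initial value is nonnegative:
on `[0, T]`, where `|g| ≤ L`, the function `-R` stays below every `ε exp ((L + 1) t)`. -/
theorem nonneg_of_hasDerivWithinAt_mul {J : Set ℝ} (hJ : J.OrdConnected) (hJ0 : (0 : ℝ) ∈ J)
    (hJpos : J ⊆ Ici 0) {R g : ℝ → ℝ} (hg : ContinuousOn g J)
    (hR : ∀ t ∈ J, HasDerivWithinAt R (R t * g t) J t) (h0 : 0 ≤ R 0) {T : ℝ} (hT : T ∈ J) :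
    0 ≤ R T := by
  have hsub : Icc 0 T ⊆ J := hJ.out hJ0 hT
  obtain ⟨L, hL⟩ := isCompact_Icc.exists_bound_of_continuousOn (hg.mono hsub)
  have key : ∀ ε : ℝ, 0 < ε → -R T ≤ ε * Real.exp ((L + 1) * T) := by
    intro ε hε
    refine le_of_hasDerivWithinAt_lt (J := Icc 0 T) ordConnected_Icc
      ⟨le_rfl, hJpos hT⟩ (fun t ht => ht.1) (f := fun t => -R t) (f' := fun t => -(R t * g t))
      (B := fun t => ε * Real.exp ((L + 1) * t))
      (B' := fun t => ε * (Real.exp ((L + 1) * t) * (L + 1)))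
      (fun t ht => ((hR t (hsub ht)).mono hsub).neg) (fun t => ?_) ?_ (fun t ht he => ?_)
      ⟨hJpos hT, le_rfl⟩
    · have h := (((hasDerivAt_id t).const_mul (L + 1)).exp).const_mul ε
      simpa using h
    · simp; linarith
    · have hb := (abs_le.1 (hL t ht)).2
      have he' : R t = -(ε * Real.exp ((L + 1) * t)) := by linarith
      have hp : 0 < ε * Real.exp ((L + 1) * t) := by positivity
      simp only [he']
      nlinarith
  by_contra! hneg
  have hE := Real.exp_pos ((L + 1) * T)
  have h := key (-R T / (2 * Real.exp ((L + 1) * T))) (by apply div_pos <;> linarith)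
  have h2 : -R T / (2 * Real.exp ((L + 1) * T)) * Real.exp ((L + 1) * T) = -R T / 2 := by
    field_simp
  linarith

/-! ### The storage function and the cross term -/

/-- The storage function of the surge subsystem in the coordinates `φ`, `z` and
`η = 2 α φ - ψ - k z`, where the Kalman–Yakubovich–Popov matrix is diagonal; `m` is meant to be
`1 / |D|`. -/
def storage (k m φ z η : ℝ) : ℝ := φ ^ 2 + k * z ^ 2 + m * η ^ 2

/-- The correction that makes the decay of the storage function visible in `z` and `η`. -/
def crossTerm (κ φ z η : ℝ) : ℝ := -φ * z + κ * η ^ 2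

/-- The quadratic part of the derivative of the storage function is nonpositive. For `D < 0` the
mixed terms cancel; for `D > 0` the form has nonpositive discriminant because `D ≤ 2 b c1`. -/
theorem storage_rate_nonpos {b c1 D m φ η : ℝ} (hb : 0 < b) (hc1 : 0 ≤ c1)
    (hD : D ≠ 0) (hDle : D ≤ 2 * b * c1) (hm : m = 1 / |D|) :
    -2 * c1 * φ ^ 2 + 2 * φ * η + 2 * m * D * φ * η - 4 * b * m * η ^ 2 ≤ 0 := by
  rcases lt_or_gt_of_ne hD with h | h
  · have hmD : m * D = -1 := by rw [hm, abs_of_neg h]; field_simp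
    have hmp : 0 < m := by rw [hm]; positivity
    have : 2 * m * D * φ * η = -2 * φ * η := by linear_combination 2 * φ * η * hmD
    have h1 : 0 ≤ c1 * φ ^ 2 := by positivity
    have h2 : 0 ≤ b * m * η ^ 2 := by positivity
    linarith
  · have hmD : m * D = 1 := by rw [hm, abs_of_pos h]; field_simp
    have hmp : 0 < m := by rw [hm]; positivity
    have h1 : 1 ≤ 2 * b * m * c1 := by nlinarith
    have h3 : b * m * (-2 * c1 * φ ^ 2 + 2 * φ * η + 2 * m * D * φ * η - 4 * b * m * η ^ 2) ≤ 0 := by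
      have e : b * m * (-2 * c1 * φ ^ 2 + 2 * φ * η + 2 * m * D * φ * η - 4 * b * m * η ^ 2)
        = -(φ - 2 * b * m * η) ^ 2 - (2 * b * m * c1 - 1) * φ ^ 2 := by
          linear_combination (2 * φ * η * b * m) * hmD
      rw [e]
      have : 0 ≤ (2 * b * m * c1 - 1) * φ ^ 2 := mul_nonneg (by linarith) (sq_nonneg _)
      nlinarith [sq_nonneg (φ - 2 * b * m * η)]
    exact nonpos_of_mul_nonpos_right h3 (by positivity)

/-- The quadratic part of the derivative of the cross term is negative definite in `(z, η)`, up to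
a multiple of `φ²`. The value of `κ` is chosen so that `-4 b κ η²` dominates the mixed terms. -/
theorem cross_rate_le {b k c1 D m κ c : ℝ} (hb : 0 < b) (hk : 0 < k) (hκ : κ = 1 / (b * k))
    (hc : c ≤ 1 / 2) (hcm : c * m ≤ 2 / k) (φ z η : ℝ) :
    -k * z ^ 2 - η * z - 4 * b * κ * η ^ 2 + c1 * φ * z + φ ^ 2 + 2 * κ * D * φ * η
      ≤ -c * storage k m φ z η + (1 + c + c1 ^ 2 / k + κ * D ^ 2 / b) * φ ^ 2 := by
  have hκp : 0 < κ := by rw [hκ]; positivity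
  have e1 : b * κ = 1 / k := by rw [hκ]; field_simp
  have h1 : -(η * z) ≤ k * z ^ 2 / 4 + η ^ 2 / k := by
    have : k * z ^ 2 / 4 + η ^ 2 / k + η * z = (k * z / 2 + η) ^ 2 / k := by field_simp; ring
    have : 0 ≤ (k * z / 2 + η) ^ 2 / k := by positivity
    linarith
  have h2 : c1 * φ * z ≤ k * z ^ 2 / 4 + c1 ^ 2 / k * φ ^ 2 := by
    have : k * z ^ 2 / 4 + c1 ^ 2 / k * φ ^ 2 - c1 * φ * z = (k * z / 2 - c1 * φ) ^ 2 / k := by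
      field_simp; ring
    have : 0 ≤ (k * z / 2 - c1 * φ) ^ 2 / k := by positivity
    linarith
  have h3 : 2 * κ * D * φ * η ≤ b * κ * η ^ 2 + κ * D ^ 2 / b * φ ^ 2 := by
    have : b * κ * η ^ 2 + κ * D ^ 2 / b * φ ^ 2 - 2 * κ * D * φ * η
      = κ * (b * η - D * φ) ^ 2 / b := by field_simp; ring
    have : 0 ≤ κ * (b * η - D * φ) ^ 2 / b := by positivity
    linarith
  have h4 : c * (k * z ^ 2) ≤ 1 / 2 * (k * z ^ 2) := mul_le_mul_of_nonneg_right hc (by positivity)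
  have h5 : c * m * η ^ 2 ≤ 2 / k * η ^ 2 := mul_le_mul_of_nonneg_right hcm (by positivity)
  have e2 : b * κ * η ^ 2 = η ^ 2 / k := by rw [e1]; ring
  have e3 : 2 / k * η ^ 2 = 2 * (η ^ 2 / k) := by ring
  unfold storage
  nlinarith

theorem abs_crossTerm_le {k m κ φ z η : ℝ} (hk : 0 < k) (hm : 0 < m) (hκ : 0 < κ) :
    |crossTerm κ φ z η| ≤ (1 + 1 / k + κ / m) * storage k m φ z η := by
  have e : (1 + 1 / k + κ / m) * storage k m φ z η
    = φ ^ 2 + z ^ 2 + κ * η ^ 2 + (k * z ^ 2 + m * η ^ 2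
      + 1 / k * (φ ^ 2 + m * η ^ 2) + κ / m * (φ ^ 2 + k * z ^ 2)) := by
    unfold storage; field_simp; ring
  have h : 0 ≤ k * z ^ 2 + m * η ^ 2
      + 1 / k * (φ ^ 2 + m * η ^ 2) + κ / m * (φ ^ 2 + k * z ^ 2) := by positivity
  have h2 : 0 ≤ κ * η ^ 2 := by positivity
  rw [e]
  unfold crossTerm
  rw [abs_le]
  constructor <;> nlinarith [sq_nonneg (φ + z), sq_nonneg (φ - z), sq_nonneg φ, sq_nonneg z]

theorem abs_le_of_storage_le {k m φ z η N : ℝ} (hk : 0 < k) (hm : 0 < m) (hN : 0 ≤ N)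
    (h : storage k m φ z η ≤ 2 * N ^ 2) :
    |φ| ≤ (2 + 2 / k + 2 / m) * N ∧ |z| ≤ (2 + 2 / k + 2 / m) * N ∧
      |η| ≤ (2 + 2 / k + 2 / m) * N := by
  unfold storage at h
  set C := 2 + 2 / k + 2 / m with hC
  have p1 : 0 < 2 / k := by positivity
  have p2 : 0 < 2 / m := by positivity
  have hkz : 0 ≤ k * z ^ 2 := by positivity
  have hme : 0 ≤ m * η ^ 2 := by positivity
  have hf := sq_nonneg φ
  have hCC : C * N ^ 2 ≤ (C * N) ^ 2 := by
    have : 0 ≤ C * (C - 1) * N ^ 2 :=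
      mul_nonneg (mul_nonneg (by linarith) (by linarith)) (sq_nonneg _)
    nlinarith
  have hCN : 0 ≤ C * N := mul_nonneg (by linarith) hN
  have key : ∀ y a : ℝ, a ≤ C → y ^ 2 ≤ a * N ^ 2 → |y| ≤ C * N := fun y a ha hy =>
    abs_le_of_sq_le_sq (by nlinarith [mul_le_mul_of_nonneg_right ha (sq_nonneg N)]) hCN
  refine ⟨key φ 2 (by linarith) (by linarith),
    key z (2 / k) (by linarith) ?_, key η (2 / m) (by linarith) ?_⟩
  · rw [div_mul_eq_mul_div, le_div_iff₀ hk]; linarith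
  · rw [div_mul_eq_mul_div, le_div_iff₀ hm]; linarith

/-! ### The sector nonlinearity and the stall disturbance -/

/-- Half of the dissipation `φ² (φ + 3/2)²` absorbs, up to a constant, a multiple of
`|φ| (φ + 3/2)²`, which bounds the contribution of `w z`: the difference is positive only for
`|φ| < h`. -/
theorem sector_absorbs_linear {φ h : ℝ} (hh : 0 ≤ h) :
    h / 2 * (|φ| * (φ + 3 / 2) ^ 2) - φ ^ 2 * (φ + 3 / 2) ^ 2 / 2 ≤ (h + 3 / 2) ^ 2 * h ^ 2 / 2 := by
  have h0 := abs_nonneg φ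
  rw [← sq_abs φ]
  rcases le_total |φ| h with hl | hl
  · have h1 : (φ + 3 / 2) ^ 2 ≤ (h + 3 / 2) ^ 2 := by
      have := abs_le.1 hl
      apply sq_le_sq' <;> linarith
    have h2 : |φ| * (h - |φ|) ≤ h ^ 2 := by nlinarith
    have h3 := mul_le_mul h1 h2 (mul_nonneg h0 (by linarith)) (sq_nonneg _)
    linarith
  · have : 0 ≤ |φ| * (|φ| - h) * (φ + 3 / 2) ^ 2 :=
      mul_nonneg (mul_nonneg h0 (by linarith)) (sq_nonneg _)
    have : 0 ≤ (h + 3 / 2) ^ 2 * h ^ 2 := by positivity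
    linarith

theorem sector_absorbs_sq (φ : ℝ) : φ ^ 2 ≤ φ ^ 2 * (φ + 3 / 2) ^ 2 / 2 + 9 := by
  rcases le_total (φ ^ 2) 9 with h | h
  · have : 0 ≤ φ ^ 2 * (φ + 3 / 2) ^ 2 := by positivity
    linarith
  · have h2 : 9 / 4 ≤ (φ + 3 / 2) ^ 2 := by
      rcases le_total 0 φ with h0 | h0
      · nlinarith
      · have : φ ≤ -3 := by nlinarith
        nlinarith
    nlinarith [mul_le_mul_of_nonneg_left h2 (sq_nonneg φ)]

/-! ### Decrease of the Lyapunov function on a high level set -/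

/-- Derivative of `storage k m φ z η` along `φ' = -c1 φ + k z + η + w / 2 + d`, `z' = -φ`,
`η' = D φ - 2 b η + 2 α d`. -/
noncomputable def storageRate (b c1 D m α φ η w d : ℝ) : ℝ :=
  -2 * c1 * φ ^ 2 + 2 * φ * η + 2 * m * D * φ * η - 4 * b * m * η ^ 2 + φ * w
    + (2 * φ + 4 * α * m * η) * d

/-- Derivative of `crossTerm κ φ z η` along the same system as in `storageRate`. -/
noncomputable def crossRate (b k c1 D κ α φ z η w d : ℝ) : ℝ :=
  -k * z ^ 2 - η * z - 4 * b * κ * η ^ 2 + c1 * φ * z + φ ^ 2 + 2 * κ * D * φ * η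
    - w * z / 2 + (-z + 4 * α * κ * η) * d

theorem abs_disturbance_le {R φ : ℝ} (hR : 0 ≤ R) :
    |-3 * R * (1 + φ)| ≤ 2 * R * (1 + (1 + φ) ^ 2) := by
  rw [abs_mul, abs_mul, abs_of_nonneg hR, abs_of_neg (by norm_num : (-3 : ℝ) < 0)]
  have : 3 * |1 + φ| ≤ 2 * (1 + (1 + φ) ^ 2) := by
    rw [← sq_abs (1 + φ)]; nlinarith [sq_nonneg (|1 + φ| - 3 / 4)]
  linarith [mul_le_mul_of_nonneg_left this hR]

/-- Bound on the coefficient with which the disturbance `d` enters the derivative of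
`storage + δ * crossTerm`. -/
theorem abs_disturbance_coeff_le {α m κ δ φ z η : ℝ} (hm : 0 < m) (hκ : 0 < κ)
    (hδ : 0 < δ) (hδ1 : δ ≤ 1) {C N : ℝ}
    (bφ : |φ| ≤ C * N) (bz : |z| ≤ C * N) (bη : |η| ≤ C * N) :
    |2 * φ + 4 * α * m * η + δ * (-z + 4 * α * κ * η)|
      ≤ C * (3 + 4 * |α| * m + 4 * |α| * κ) * N := by
  have a1 : |2 * φ| ≤ 2 * (C * N) := by
    rw [abs_mul, abs_of_pos (by norm_num : (0 : ℝ) < 2)]; linarith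
  have a2 : |4 * α * m * η| ≤ 4 * |α| * m * (C * N) := by
    rw [abs_mul, abs_mul, abs_mul, abs_of_pos hm, abs_of_pos (by norm_num : (0 : ℝ) < 4)]
    gcongr
  have a3 : |-z + 4 * α * κ * η| ≤ C * N + 4 * |α| * κ * (C * N) := by
    refine (abs_add_le _ _).trans (add_le_add (by rwa [abs_neg]) ?_)
    rw [abs_mul, abs_mul, abs_mul, abs_of_pos hκ, abs_of_pos (by norm_num : (0 : ℝ) < 4)]
    gcongr
  have a4 : |δ * (-z + 4 * α * κ * η)| ≤ C * N + 4 * |α| * κ * (C * N) := by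
    rw [abs_mul, abs_of_pos hδ]
    exact (mul_le_of_le_one_left (abs_nonneg _) hδ1).trans a3
  refine (abs_add_le _ _).trans ?_
  have := abs_add_le (2 * φ) (4 * α * m * η)
  linarith

/-- With `δ = n⁻³` and `V` of order `n⁸`, the term `-δ c V` is of order `-n⁵`. The disturbance and
the sector nonlinearity leave only terms of order `n⁴`, so the derivative of
`V + F n⁴ R + δ crossTerm` is negative once `n` is large. -/
theorem lyapunov_rate_neg {b k c1 D m κ c C L E F α σ ρ n δ : ℝ} (hb : 0 < b) (hk : 0 < k)
    (hc1 : 0 ≤ c1) (hD : D ≠ 0) (hDle : D ≤ 2 * b * c1) (hm : m = 1 / |D|) (hmp : 0 < m)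
    (hκ : κ = 1 / (b * k)) (hκp : 0 < κ) (hc : 0 < c) (hc2 : c ≤ 1 / 2) (hcm : c * m ≤ 2 / k)
    (hC : C = 2 + 2 / k + 2 / m) (hCp : 0 < C)
    (hL : L = C * (3 + 4 * |α| * m + 4 * |α| * κ)) (hLp : 0 < L)
    (hE : E = 1 + c + c1 ^ 2 / k + κ * D ^ 2 / b) (hFσ : F * σ = 2 * L)
    (hn2 : 2 ≤ n) (hδp : 0 < δ) (hδn : δ * n ^ 3 = 1) (hδ1 : δ ≤ 1) (hδE : δ * E ≤ 1)
    (hnc : 2 * (9 + (C + 1) ^ 2 * C ^ 2 / 2 + 4 * L * ρ) < c * n)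
    {φ z η R w d : ℝ} (hR : 0 ≤ R) (hRρ : R ≤ ρ)
    (hVup : storage k m φ z η ≤ 2 * (n ^ 4) ^ 2) (hVlow : (n ^ 4) ^ 2 / 2 ≤ storage k m φ z η)
    (hw : w = -φ * (φ + 3 / 2) ^ 2) (hd : d = -3 * R * (1 + φ)) :
    storageRate b c1 D m α φ η w d
      + F * n ^ 4 * (-σ * R ^ 2 - σ * R * (2 * φ + φ ^ 2))
      + δ * crossRate b k c1 D κ α φ z η w d < 0 := by
  have hnp : 0 < n := by linarith
  have h1n4 : 1 ≤ n ^ 4 := one_le_pow₀ (by linarith)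
  obtain ⟨bφ, bz, bη⟩ := abs_le_of_storage_le hk hmp (by positivity) hVup
  rw [← hC] at bφ bz bη
  have hs := storage_rate_nonpos (φ := φ) (η := η) hb hc1 hD hDle hm
  have hx := cross_rate_le (c1 := c1) (D := D) hb hk hκ hc2 hcm φ z η
  rw [← hE] at hx
  have hdist : (2 * φ + 4 * α * m * η + δ * (-z + 4 * α * κ * η)) * d
      ≤ L * n ^ 4 * (2 * R * (1 + (1 + φ) ^ 2)) := by
    refine (le_abs_self _).trans ?_
    rw [abs_mul, hd, hL]
    exact mul_le_mul (abs_disturbance_coeff_le hmp hκp hδp hδ1 bφ bz bη)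
      (abs_disturbance_le hR) (abs_nonneg _) (by positivity)
  -- `F σ = 2 L` makes the decay of `R` cancel the factor `(1 + φ)²` of the disturbance bound
  have hRterm : F * n ^ 4 * (-σ * R ^ 2 - σ * R * (2 * φ + φ ^ 2))
      + L * n ^ 4 * (2 * R * (1 + (1 + φ) ^ 2)) ≤ 4 * L * ρ * n ^ 4 := by
    have e : F * n ^ 4 * (-σ * R ^ 2 - σ * R * (2 * φ + φ ^ 2))
      + L * n ^ 4 * (2 * R * (1 + (1 + φ) ^ 2)) = L * n ^ 4 * (4 * R - 2 * R ^ 2) := by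
      linear_combination (n ^ 4 * (-R ^ 2 - R * (2 * φ + φ ^ 2))) * hFσ
    rw [e]
    have : L * n ^ 4 * (4 * R - 2 * R ^ 2) ≤ L * n ^ 4 * (4 * ρ) :=
      mul_le_mul_of_nonneg_left (by linarith only [hRρ, sq_nonneg R]) (by positivity)
    linarith
  have hφw : φ * w = -(φ ^ 2 * (φ + 3 / 2) ^ 2) := by rw [hw]; ring
  -- `C n` bounds `δ |z|`
  have hh : δ * (C * n ^ 4) = C * n := by linear_combination (C * n) * hδn
  have hwz : δ * (-w * z / 2) ≤ C * n / 2 * (|φ| * (φ + 3 / 2) ^ 2) := by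
    rw [← hh]
    have e : -w * z / 2 = φ * z * ((φ + 3 / 2) ^ 2 / 2) := by rw [hw]; ring
    have h1 : φ * z ≤ |φ| * (C * n ^ 4) := by
      refine (le_abs_self _).trans ?_
      rw [abs_mul]; gcongr
    have h2 := mul_le_mul_of_nonneg_right h1 (by positivity : 0 ≤ (φ + 3 / 2) ^ 2 / 2)
    have h3 := mul_le_mul_of_nonneg_left h2 hδp.le
    rw [e]; linarith only [h3]
  have hsec := sector_absorbs_linear (φ := φ) (h := C * n) (by positivity)
  have hsec2 : (C * n + 3 / 2) ^ 2 * (C * n) ^ 2 / 2 ≤ (C + 1) ^ 2 * C ^ 2 / 2 * n ^ 4 := by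
    have h1 : (C * n + 3 / 2) ^ 2 ≤ ((C + 1) * n) ^ 2 := by
      apply pow_le_pow_left₀ (by positivity); linarith only [hn2]
    have h2 := mul_le_mul_of_nonneg_right h1 (by positivity : 0 ≤ (C * n) ^ 2)
    linarith only [h2]
  have hsq := sector_absorbs_sq φ
  have hEφ : δ * (E * φ ^ 2) ≤ φ ^ 2 * (φ + 3 / 2) ^ 2 / 2 + 9 := by
    have := mul_le_mul_of_nonneg_right hδE (sq_nonneg φ)
    linarith only [this, hsq]
  have hcV : c * n * n ^ 4 / 2 ≤ δ * (c * storage k m φ z η) := by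
    have h1 := mul_le_mul_of_nonneg_left hVlow (mul_pos hδp hc).le
    have e : δ * c * ((n ^ 4) ^ 2 / 2) = c * n * n ^ 4 / 2 := by
      linear_combination (c * n ^ 5 / 2) * hδn
    linarith only [h1, e]
  have hfin := mul_lt_mul_of_pos_right hnc (by positivity : 0 < n ^ 4)
  have hx' := mul_le_mul_of_nonneg_left hx hδp.le
  have hsum : storageRate b c1 D m α φ η w d
      + F * n ^ 4 * (-σ * R ^ 2 - σ * R * (2 * φ + φ ^ 2))
      + δ * crossRate b k c1 D κ α φ z η w d
      = (-2 * c1 * φ ^ 2 + 2 * φ * η + 2 * m * D * φ * η - 4 * b * m * η ^ 2) + φ * w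
      + (2 * φ + 4 * α * m * η + δ * (-z + 4 * α * κ * η)) * d
      + F * n ^ 4 * (-σ * R ^ 2 - σ * R * (2 * φ + φ ^ 2))
      + δ * (-k * z ^ 2 - η * z - 4 * b * κ * η ^ 2 + c1 * φ * z + φ ^ 2 + 2 * κ * D * φ * η)
      + δ * (-w * z / 2) := by
    unfold storageRate crossRate; ring
  rw [hsum, hφw]
  linarith only [hs, hdist, hRterm, hwz, hsec, hsec2, hEφ, hcV, hfin, hx', h1n4]

/-- There is a Lyapunov function `U = V + K R + δ crossTerm` and a level `N²` such that `U ≤ N²`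
bounds the state, the states with `V ≤ v` lie in the sublevel set, and `U` decreases strictly on
the level set `U = N²`. The weights `K` and `δ` depend on the level. -/
theorem exists_invariant_level {b k c1 D : ℝ} (α : ℝ) {σ ρ : ℝ} (v : ℝ) (hb : 0 < b) (hk : 0 < k)
    (hc1 : 0 ≤ c1) (hD : D ≠ 0) (hDle : D ≤ 2 * b * c1) (hσ : 0 < σ) (hρ : 0 ≤ ρ) :
    ∃ κ K δ N : ℝ, 0 ≤ N ∧
      (∀ φ z η R, 0 ≤ R →
        storage k (1 / |D|) φ z η + K * R + δ * crossTerm κ φ z η ≤ N ^ 2 →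
        storage k (1 / |D|) φ z η ≤ 2 * N ^ 2) ∧
      (∀ φ z η R, R ≤ ρ → storage k (1 / |D|) φ z η ≤ v →
        storage k (1 / |D|) φ z η + K * R + δ * crossTerm κ φ z η ≤ N ^ 2) ∧
      (∀ φ z η R w d, 0 ≤ R → R ≤ ρ →
        storage k (1 / |D|) φ z η + K * R + δ * crossTerm κ φ z η = N ^ 2 →
        w = -φ * (φ + 3 / 2) ^ 2 → d = -3 * R * (1 + φ) →
        storageRate b c1 D (1 / |D|) α φ η w d
          + K * (-σ * R ^ 2 - σ * R * (2 * φ + φ ^ 2))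
          + δ * crossRate b k c1 D κ α φ z η w d < 0) := by
  obtain ⟨m, hm⟩ : ∃ m, m = 1 / |D| := ⟨_, rfl⟩
  have hmp : 0 < m := by rw [hm]; positivity
  rw [← hm]
  obtain ⟨κ, hκ⟩ : ∃ κ, κ = 1 / (b * k) := ⟨_, rfl⟩
  have hκp : 0 < κ := by rw [hκ]; positivity
  obtain ⟨c, hc, hc2, hcm⟩ : ∃ c : ℝ, 0 < c ∧ c ≤ 1 / 2 ∧ c * m ≤ 2 / k := by
    refine ⟨min (1 / 2) (2 / k / m), by positivity, min_le_left _ _, ?_⟩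
    calc _ ≤ 2 / k / m * m := mul_le_mul_of_nonneg_right (min_le_right _ _) hmp.le
      _ = _ := by field_simp
  obtain ⟨C, hC⟩ : ∃ C, C = 2 + 2 / k + 2 / m := ⟨_, rfl⟩
  have hCp : 0 < C := by rw [hC]; positivity
  obtain ⟨L, hL⟩ : ∃ L, L = C * (3 + 4 * |α| * m + 4 * |α| * κ) := ⟨_, rfl⟩
  have hLp : 0 < L := by rw [hL]; positivity
  obtain ⟨E, hE⟩ : ∃ E, E = 1 + c + c1 ^ 2 / k + κ * D ^ 2 / b := ⟨_, rfl⟩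
  have hEp : 0 < E := by rw [hE]; positivity
  obtain ⟨G, hG⟩ : ∃ G, G = 1 + 1 / k + κ / m := ⟨_, rfl⟩
  have hGp : 0 < G := by rw [hG]; positivity
  obtain ⟨F, hF⟩ : ∃ F, F = 2 * L / σ := ⟨_, rfl⟩
  have hFp : 0 < F := by rw [hF]; positivity
  have hFσ : F * σ = 2 * L := by rw [hF]; field_simp
  -- each summand makes `n` dominate one of the constants met below
  obtain ⟨n, hn⟩ : ∃ n, n = 2 + E + 2 * G + 2 * |v| + 4 * F * ρ
      + 2 * (9 + (C + 1) ^ 2 * C ^ 2 / 2 + 4 * L * ρ) / c := ⟨_, rfl⟩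
  have hFρ : 0 ≤ F * ρ := by positivity
  have hlast : 0 ≤ 2 * (9 + (C + 1) ^ 2 * C ^ 2 / 2 + 4 * L * ρ) / c := by positivity
  have hv := abs_nonneg v
  have hn2 : 2 ≤ n := by rw [hn]; linarith
  have hnE : E ≤ n := by rw [hn]; linarith
  have hnG : 2 * G ≤ n := by rw [hn]; linarith
  have hnv : 2 * |v| + 4 * F * ρ ≤ n := by rw [hn]; linarith
  have hnc : 2 * (9 + (C + 1) ^ 2 * C ^ 2 / 2 + 4 * L * ρ) < c * n := by
    have h : 2 * (9 + (C + 1) ^ 2 * C ^ 2 / 2 + 4 * L * ρ) / c < n := by rw [hn]; linarith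
    rwa [div_lt_iff₀ hc, mul_comm n c] at h
  have hnp : 0 < n := by linarith
  have hn3 : n ≤ n ^ 3 := le_self_pow₀ (by linarith) (by norm_num)
  have hn4 : n ≤ n ^ 4 := le_self_pow₀ (by linarith) (by norm_num)
  have h1n4 : 1 ≤ n ^ 4 := by linarith
  obtain ⟨δ, hδ⟩ : ∃ δ, δ = 1 / n ^ 3 := ⟨_, rfl⟩
  have hδp : 0 < δ := by rw [hδ]; positivity
  have hδn : δ * n ^ 3 = 1 := by rw [hδ]; field_simp
  have hδle : ∀ x, x ≤ n → δ * x ≤ 1 := fun x hx =>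
    (mul_le_mul_of_nonneg_left (hx.trans hn3) hδp.le).trans hδn.le
  have hδ1 : δ ≤ 1 := by linarith [hδle 1 (by linarith)]
  have hδE : δ * E ≤ 1 := hδle E hnE
  have hδG : δ * G ≤ 1 / 2 := by linarith [hδle (2 * G) hnG]
  have hsn : ∀ φ z η, 0 ≤ storage k m φ z η := fun φ z η => by unfold storage; positivity
  have hcross : ∀ φ z η, |δ * crossTerm κ φ z η| ≤ storage k m φ z η / 2 := by
    intro φ z η
    rw [abs_mul, abs_of_pos hδp]
    have h1 := abs_crossTerm_le (φ := φ) (z := z) (η := η) hk hmp hκp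
    rw [← hG] at h1
    have h2 := mul_le_mul_of_nonneg_left h1 hδp.le
    have h3 := mul_le_mul_of_nonneg_right hδG (hsn φ z η)
    linarith
  have hup : ∀ φ z η R, 0 ≤ R →
      storage k m φ z η + F * n ^ 4 * R + δ * crossTerm κ φ z η ≤ (n ^ 4) ^ 2 →
      storage k m φ z η ≤ 2 * (n ^ 4) ^ 2 := by
    intro φ z η R hR h
    have h1 := (abs_le.1 (hcross φ z η)).1
    have : 0 ≤ F * n ^ 4 * R := by positivity
    linarith
  refine ⟨κ, F * n ^ 4, δ, n ^ 4, by positivity, hup, ?_, ?_⟩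
  · intro φ z η R hR h
    have h1 := (abs_le.1 (hcross φ z η)).2
    have h2 : F * n ^ 4 * R ≤ F * n ^ 4 * ρ := mul_le_mul_of_nonneg_left hR (by positivity)
    have h3 := le_abs_self v
    have h4 : (2 * |v| + 4 * F * ρ) * n ^ 4 ≤ n ^ 4 * n ^ 4 :=
      mul_le_mul_of_nonneg_right (by linarith) (by positivity)
    have h5 : |v| ≤ |v| * n ^ 4 := le_mul_of_one_le_right hv h1n4
    have h6 : 0 ≤ F * ρ * n ^ 4 := by positivity
    linarith only [h, h1, h2, h3, h4, h5, h6, hv]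
  · intro φ z η R w d hR hRρ hU hw hd
    have hVup := hup φ z η R hR hU.le
    have hVlow : (n ^ 4) ^ 2 / 2 ≤ storage k m φ z η := by
      have h1 := (abs_le.1 (hcross φ z η)).2
      have h2 : F * n ^ 4 * R ≤ F * n ^ 4 * ρ := mul_le_mul_of_nonneg_left hRρ (by positivity)
      have h4 : (4 * F * ρ) * n ^ 4 ≤ n ^ 4 * n ^ 4 :=
        mul_le_mul_of_nonneg_right (by linarith) (by positivity)
      linarith only [hU, h1, h2, h4]
    exact lyapunov_rate_neg hb hk hc1 hD hDle hm hmp hκ hκp hc hc2 hcm hC hCp hL hLp hE hFσ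
      hn2 hδp hδn hδ1 hδE hnc hR hRρ hVup hVlow hw hd

/-! ### What the circle conditions say about the coefficients -/

/-- Nonnegativity of an affine function on the positive axis minus a point; letting `x` tend to
`∞` and to `0` gives the two coefficients. -/
theorem nonneg_of_forall_pos_ne {a c : ℝ} (q : ℝ) (h : ∀ x : ℝ, 0 < x → x ≠ q → 0 ≤ x * a + c) :
    0 ≤ a ∧ 0 ≤ c := by
  constructor
  · by_contra! ha
    have h1 : 0 ≤ |c| / -a := div_nonneg (abs_nonneg _) (by linarith)
    have h2 : |c| / -a * a = -|c| := by
      have := ha.ne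
      field_simp
    have h3 := abs_nonneg q
    have := h (|c| / -a + |q| + 1) (by linarith) (by linarith [le_abs_self q])
    nlinarith [le_abs_self c, abs_nonneg c]
  · by_contra! hc
    have key : ∀ x : ℝ, 0 < x → x * (|a| + 1) < -c → x * a + c < 0 := fun x hx hlt => by
      nlinarith [le_abs_self a]
    have hp : 0 < -c / (|a| + 1) := div_pos (by linarith) (by positivity)
    have e : -c / (|a| + 1) * (|a| + 1) = -c := by field_simp
    by_cases hq : -c / (|a| + 1) / 2 = q
    · exact absurd (h (-c / (|a| + 1) / 3) (by linarith) (by linarith))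
        (not_le.2 (key _ (by linarith) (by linarith)))
    · exact absurd (h (-c / (|a| + 1) / 2) (by linarith) hq)
        (not_le.2 (key _ (by linarith) (by linarith)))

theorem quadratic_coeff_pos_of_roots {u v : ℝ}
    (h : ∀ s : ℂ, s ^ 2 + u * s + v = 0 → s.re < 0) : 0 < u ∧ 0 < v := by
  obtain ⟨r, hr⟩ := IsAlgClosed.exists_pow_nat_eq ((u : ℂ) ^ 2 - 4 * v) (n := 2) (by norm_num)
  have h1 := h ((-u + r) / 2) (by linear_combination hr / 4)
  have h2 := h ((-u - r) / 2) (by linear_combination hr / 4)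
  have e1 : ((-(u : ℂ) + r) / 2).re = (-u + r.re) / 2 := by
    have : (-(u : ℂ) + r) / 2 = ((1 / 2 : ℝ) : ℂ) * (-(u : ℂ) + r) := by push_cast; ring
    rw [this, Complex.re_ofReal_mul]; simp; ring
  have e2 : ((-(u : ℂ) - r) / 2).re = (-u - r.re) / 2 := by
    have : (-(u : ℂ) - r) / 2 = ((1 / 2 : ℝ) : ℂ) * (-(u : ℂ) - r) := by push_cast; ring
    rw [this, Complex.re_ofReal_mul]; simp; ring
  rw [e1] at h1
  rw [e2] at h2
  have hre := congrArg Complex.re hr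
  simp [pow_two] at hre
  refine ⟨by linarith, ?_⟩
  nlinarith [mul_self_nonneg r.im]

/-- The part of the Routh–Hurwitz criterion for real cubics that is needed here. A real root is
split off and the remaining quadratic factor is treated separately. -/
theorem cubic_coeff_pos_of_roots {p2 p1 p0 : ℝ}
    (h : ∀ s : ℂ, s ^ 3 + p2 * s ^ 2 + p1 * s + p0 = 0 → s.re < 0) : 0 < p1 ∧ 0 < p0 := by
  obtain ⟨x, hx⟩ : ∃ x : ℝ, x ^ 3 + p2 * x ^ 2 + p1 * x + p0 = 0 := by
    -- Cauchy's bound: the cubic changes sign on `[-M, M]`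
    set M := 1 + |p2| + |p1| + |p0| with hM
    have a2 := abs_le.1 (le_refl |p2|)
    have a1 := abs_le.1 (le_refl |p1|)
    have a0 := abs_le.1 (le_refl |p0|)
    have h2 := abs_nonneg p2
    have h1 := abs_nonneg p1
    have h0 := abs_nonneg p0
    have hM1 : 1 ≤ M := by linarith
    have hMM : M ≤ M ^ 2 := by nlinarith
    have b2 : |p2| * M ^ 2 + |p1| * M + |p0| ≤ M ^ 3 := by
      have : |p1| * M ≤ |p1| * M ^ 2 := mul_le_mul_of_nonneg_left hMM h1
      have : |p0| * 1 ≤ |p0| * M ^ 2 := mul_le_mul_of_nonneg_left (by linarith) h0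
      have : (|p2| + |p1| + |p0|) * M ^ 2 ≤ M * M ^ 2 :=
        mul_le_mul_of_nonneg_right (by linarith) (by positivity)
      linarith
    have c2 : |p2 * M ^ 2| = |p2| * M ^ 2 := by rw [abs_mul, abs_of_nonneg (sq_nonneg M)]
    have c1 : |p1 * M| = |p1| * M := by rw [abs_mul, abs_of_nonneg (by linarith : 0 ≤ M)]
    have d2 := abs_le.1 c2.le
    have d1 := abs_le.1 c1.le
    have hcont : ContinuousOn (fun x : ℝ => x ^ 3 + p2 * x ^ 2 + p1 * x + p0) (Icc (-M) M) := by
      fun_prop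
    obtain ⟨x, -, hx⟩ := intermediate_value_Icc (by linarith) hcont
      (show (0 : ℝ) ∈ Icc _ _ from ⟨by ring_nf at *; linarith, by linarith⟩)
    exact ⟨x, hx⟩
  have hxC : (x : ℂ) ^ 3 + p2 * (x : ℂ) ^ 2 + p1 * x + p0 = 0 := by exact_mod_cast hx
  have hneg : x < 0 := by simpa using h x hxC
  obtain ⟨hu, hv⟩ := quadratic_coeff_pos_of_roots (u := p2 + x) (v := p1 + x * (p2 + x))
    fun s hs => by
    refine h s ?_
    push_cast at hs
    linear_combination (s - x) * hs + hxC
  refine ⟨by nlinarith, ?_⟩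
  have : p0 = -x * (p1 + x * (p2 + x)) := by linear_combination hx
  rw [this]
  exact mul_pos (by linarith) hv

theorem det_pencil_matA (lphi lpsi lz : ℝ) (s : ℂ) :
    (pencil (matA lphi lpsi lz) s).det
      = s ^ 3 - (3 / 2 + lpsi) * s ^ 2 + (3 / 2 * lpsi + lphi) * s - lz := by
  simp [pencil, matA, Matrix.det_fin_three]
  ring

/-- The transfer function is the quotient of `s (s / 2 - (lpsi / 2 + α))` by the characteristic
polynomial, in a form without division. -/
theorem transfer_mul_det {lphi lpsi lz α : ℝ} {s : ℂ}
    (hs : IsUnit (pencil (matA lphi lpsi lz) s).det) :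
    (s ^ 3 - (3 / 2 + lpsi) * s ^ 2 + (3 / 2 * lpsi + lphi) * s - lz)
      * transfer (matA lphi lpsi lz) (matB α) matC s = s * (s / 2 - (lpsi / 2 + α)) := by
  set X := (pencil (matA lphi lpsi lz) s)⁻¹ * (matB α).map Complex.ofReal with hX
  have hT : transfer (matA lphi lpsi lz) (matB α) matC s = X 0 0 := by
    rw [transfer, Matrix.mul_assoc, ← hX]
    simp [matC, Matrix.mul_apply, Fin.sum_univ_three]
  have hmul : pencil (matA lphi lpsi lz) s * X = (matB α).map Complex.ofReal := by
    rw [hX, Matrix.mul_nonsing_inv_cancel_left _ _ hs]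
  have h0 := congrFun (congrFun hmul 0) 0
  have h1 := congrFun (congrFun hmul 1) 0
  have h2 := congrFun (congrFun hmul 2) 0
  simp [pencil, matA, matB, Matrix.mul_apply, Fin.sum_univ_three] at h0 h1 h2
  rw [hT]
  linear_combination (s - lpsi) * s * h0 - s * h1 - lz * h2

/-- The coefficients of `s` and `1` in the characteristic polynomial of `A - 3/4 B C` are
positive. -/
theorem CircleConditions.hurwitz_coeff_pos {lphi lpsi lz α : ℝ}
    (h : CircleConditions lphi lpsi lz α) :
    0 < 9 / 8 * lpsi + (lphi - 3 / 4 * α) ∧ 0 < -lz := by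
  refine cubic_coeff_pos_of_roots (p2 := -(9 / 8 + lpsi)) fun s hs => h.hurwitz s ?_
  rw [spectrum.mem_iff, Matrix.isUnit_iff_isUnit_det, isUnit_iff_ne_zero, not_not]
  push_cast at hs
  rw [← hs, Algebra.algebraMap_eq_smul_one]
  simp [matA, matB, matC, Matrix.det_fin_three]
  ring

/-- At a frequency `ω` with `ω² = x`, the frequency inequality multiplied by the squared modulus of
the characteristic polynomial is `x` times an affine function of `x`; the two inequalities say that
its coefficients are nonnegative. The inequality is not available at the single positive frequency
where `jω - A` may be singular, which does no harm to an affine function. -/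
theorem CircleConditions.frequency_coeff_nonneg {lphi lpsi lz α : ℝ}
    (h : CircleConditions lphi lpsi lz α) :
    0 ≤ -(9 / 8 + lpsi) / 2 + (lpsi / 2 + α) ∧
      0 ≤ -(lpsi / 2 + α) * (9 / 8 * lpsi + (lphi - 3 / 4 * α)) + lz / 2 := by
  refine nonneg_of_forall_pos_ne (3 / 2 * lpsi + lphi) fun x hx hxq => ?_
  set ω := √x
  have hω : 0 < ω := Real.sqrt_pos.2 hx
  have hωx : ω ^ 2 = x := Real.sq_sqrt hx.le
  set P : ℂ := ⟨(3 / 2 + lpsi) * ω ^ 2 - lz, -ω ^ 3 + (3 / 2 * lpsi + lphi) * ω⟩ with hP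
  have hdet : (pencil (matA lphi lpsi lz) (Complex.I * ω)).det = P := by
    rw [det_pencil_matA]
    apply Complex.ext <;> simp [hP, pow_succ]
  have hu : IsUnit (pencil (matA lphi lpsi lz) (Complex.I * ω)).det := by
    rw [hdet, isUnit_iff_ne_zero]
    intro h0
    have him := congrArg Complex.im h0
    simp [hP] at him
    have : ω * (x - (3 / 2 * lpsi + lphi)) = 0 := by rw [← hωx]; linarith
    rcases mul_eq_zero.1 this with h | h
    · exact hω.ne' h
    · exact hxq (by linarith)
  have hf := h.frequency ω hω.le hu
  have hT := transfer_mul_det (α := α) hu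
  rw [← det_pencil_matA, hdet] at hT
  generalize transfer (matA lphi lpsi lz) (matB α) matC (Complex.I * ω) = T at hf hT
  have hP0 : 0 < Complex.normSq P := by
    rw [Complex.normSq_pos, ← hdet]; exact hu.ne_zero
  rw [Complex.sq_norm, Complex.normSq_apply] at hf
  have hre := congrArg Complex.re hT
  have him := congrArg Complex.im hT
  rw [Complex.normSq_apply] at hP0
  simp [Complex.mul_re, Complex.mul_im] at hre him
  have hPr : P.re = (3 / 2 + lpsi) * ω ^ 2 - lz := rfl
  have hPi : P.im = -ω ^ 3 + (3 / 2 * lpsi + lphi) * ω := rfl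
  have hN : (P.re * P.re + P.im * P.im)
      * (-T.re - 3 / 4 * (T.re * T.re + T.im * T.im)) ≤ 0 :=
    mul_nonpos_of_nonneg_of_nonpos hP0.le hf
  have e1 : (P.re * P.re + P.im * P.im) * T.re
      = -(ω * (ω / 2)) * P.re + ω * (-α + -(lpsi / 2)) * P.im := by
    linear_combination P.re * hre + P.im * him
  have e2 : (P.re * P.re + P.im * P.im) * (T.re * T.re + T.im * T.im)
      = (ω * (ω / 2)) ^ 2 + (ω * (-α + -(lpsi / 2))) ^ 2 := by
    rw [← him]
    linear_combination (P.re * T.re - P.im * T.im - ω * (ω / 2)) * hre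
  have e3 : (P.re * P.re + P.im * P.im)
      * (-T.re - 3 / 4 * (T.re * T.re + T.im * T.im))
      = -(-(ω * (ω / 2)) * P.re + ω * (-α + -(lpsi / 2)) * P.im)
        - 3 / 4 * ((ω * (ω / 2)) ^ 2 + (ω * (-α + -(lpsi / 2))) ^ 2) := by
    linear_combination -e1 - 3 / 4 * e2
  rw [e3, hPr, hPi] at hN
  rw [← hωx]
  refine nonneg_of_mul_nonneg_right (a := ω ^ 2) ?_ (by positivity)
  linarith only [hN]

/-- The coefficient with which `φ` drives `η = 2 α φ - ψ - k z` does not vanish. Otherwise the row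
vector of `η` would be a left eigenvector of `A` orthogonal to `B`, and `(A, B)` would not be
controllable. -/
theorem CircleConditions.coupling_ne_zero {lphi lpsi lz α k : ℝ}
    (h : CircleConditions lphi lpsi lz α)
    (hk : 2 * (-(lpsi / 2 + α)) * k = -lz) :
    2 * α * (9 / 8) - (lphi - 3 / 4 * α) + k + 4 * α * (-(lpsi / 2 + α)) ≠ 0 := by
  intro h0
  have hc := h.controllable
  unfold IsControllable at hc
  set A := matA lphi lpsi lz
  set v : Fin 3 → ℝ := ![2 * α, -1, -k]
  have hvB : Matrix.vecMul v (matB α) = 0 := by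
    ext i; fin_cases i; simp [v, matB, Matrix.vecMul, dotProduct, Fin.sum_univ_three]; ring
  have hvA : Matrix.vecMul v A = (lpsi + 2 * α) • v := by
    ext i
    fin_cases i <;> simp [v, A, matA, Matrix.vecMul, dotProduct, Fin.sum_univ_three] <;> linarith
  have hpow : ∀ j : ℕ, Matrix.vecMul v (A ^ j) = (lpsi + 2 * α) ^ j • v := by
    intro j
    induction j with
    | zero => simp
    | succ j ih =>
      rw [pow_succ, ← Matrix.vecMul_vecMul, ih, Matrix.smul_vecMul, hvA, smul_smul, pow_succ]
  set M : Matrix (Fin 3) (Fin 3 × Fin 1) ℝ :=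
    Matrix.of fun (i : Fin 3) (p : Fin 3 × Fin 1) => (A ^ (p.1 : ℕ) * matB α) i p.2 with hM
  have hvM : Matrix.vecMul v M = 0 := by
    ext p
    have : Matrix.vecMul v M p = Matrix.vecMul v (A ^ (p.1 : ℕ) * matB α) p.2 := rfl
    rw [this, ← Matrix.vecMul_vecMul, hpow, Matrix.smul_vecMul, hvB]; simp
  have hli : LinearIndependent ℝ M.row := by
    rw [linearIndependent_iff_card_eq_finrank_span, Set.finrank,
      ← Matrix.rank_eq_finrank_span_row, hc]
    simp
  have hv0 : v = 0 := (Matrix.vecMul_injective_iff.2 hli) (by simp [hvM])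
  have := congrFun hv0 1
  simp [v] at this

/-! ### Boundedness of solutions -/

theorem hasDerivWithinAt_storage {b k c1 D α φ₀ η₀ z₀ w d : ℝ} (m : ℝ) {φ z η : ℝ → ℝ} {J : Set ℝ}
    {t : ℝ} (h1 : φ t = φ₀) (h2 : z t = z₀) (h3 : η t = η₀)
    (hφ : HasDerivWithinAt φ (-c1 * φ₀ + k * z₀ + η₀ + w / 2 + d) J t)
    (hz : HasDerivWithinAt z (-φ₀) J t)
    (hη : HasDerivWithinAt η (D * φ₀ - 2 * b * η₀ + 2 * α * d) J t) :
    HasDerivWithinAt (fun s => storage k m (φ s) (z s) (η s))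
      (storageRate b c1 D m α φ₀ η₀ w d) J t := by
  unfold storage
  refine (((hφ.fun_pow 2).add ((hz.fun_pow 2).const_mul k)).add
    ((hη.fun_pow 2).const_mul m)).congr_deriv ?_
  rw [h1, h2, h3]
  unfold storageRate
  push_cast
  ring

theorem hasDerivWithinAt_crossTerm {b k c1 D α φ₀ η₀ z₀ w d : ℝ} (κ : ℝ) {φ z η : ℝ → ℝ}
    {J : Set ℝ} {t : ℝ} (h1 : φ t = φ₀) (h2 : z t = z₀) (h3 : η t = η₀)
    (hφ : HasDerivWithinAt φ (-c1 * φ₀ + k * z₀ + η₀ + w / 2 + d) J t)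
    (hz : HasDerivWithinAt z (-φ₀) J t)
    (hη : HasDerivWithinAt η (D * φ₀ - 2 * b * η₀ + 2 * α * d) J t) :
    HasDerivWithinAt (fun s => crossTerm κ (φ s) (z s) (η s))
      (crossRate b k c1 D κ α φ₀ z₀ η₀ w d) J t := by
  unfold crossTerm
  refine ((hφ.fun_neg.fun_mul hz).add ((hη.fun_pow 2).const_mul κ)).congr_deriv ?_
  rw [h1, h2, h3]
  unfold crossRate
  push_cast
  ring

/-- The stall variable stays in a fixed interval whatever `φ` does: it cannot
become negative, and `R' = σ R (1 - R - (1 + φ)²)` is negative for `R > 1`. -/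
theorem stall_mem_Icc {σ : ℝ} (hσ : 0 < σ) {J : Set ℝ} (hJ : J.OrdConnected)
    (hJ0 : (0 : ℝ) ∈ J) (hJpos : J ⊆ Ici 0) {φ R : ℝ → ℝ} (hφ : ContinuousOn φ J)
    (hR : ∀ t ∈ J, HasDerivWithinAt R
      (-σ * R t ^ 2 - σ * R t * (2 * φ t + φ t ^ 2)) J t)
    (hR0 : 0 ≤ R 0) {t : ℝ} (ht : t ∈ J) : R t ∈ Icc 0 (R 0 + 2) := by
  have hRc : ContinuousOn R J := fun s hs => (hR s hs).continuousWithinAt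
  constructor
  · refine nonneg_of_hasDerivWithinAt_mul hJ hJ0 hJpos
      (g := fun s => -σ * R s - σ * (2 * φ s + φ s ^ 2)) (by fun_prop)
      (fun s hs => (hR s hs).congr_deriv (by ring)) hR0 ht
  · refine le_of_hasDerivWithinAt_lt hJ hJ0 hJpos hR (fun s => hasDerivAt_const s (R 0 + 2))
      (by linarith) (fun s _ he => ?_) ht
    rw [he]
    nlinarith [mul_pos hσ (by linarith : 0 < R 0 + 2), sq_nonneg (1 + φ s),
      mul_nonneg (mul_pos hσ (by linarith : 0 < R 0 + 2)).le (sq_nonneg (1 + φ s)),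
      mul_pos (mul_pos hσ (by linarith : 0 < R 0 + 2)) (by linarith : 0 < R 0 + 1)]

end MooreGreitzer

open MooreGreitzer

theorem theorem1 (β σ lphi lpsi lz α : ℝ) (hβ : 0 < β) (hσ : 0 < σ)
    (hpar : MooreGreitzer.CircleConditions lphi lpsi lz α)
    (J : Set ℝ) (hJ : J.OrdConnected) (hJ0 : (0 : ℝ) ∈ J) (hJpos : J ⊆ Set.Ici 0)
    (φ ψ z R u : ℝ → ℝ)
    (hmodel : MooreGreitzer.IsModelSolution β σ u φ ψ R J)
    (hctrl : MooreGreitzer.IsControllerOutput β lphi lpsi lz α φ ψ z u J) :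
    ∃ M : ℝ, ∀ t ∈ J, |φ t| ≤ M ∧ |ψ t| ≤ M ∧ |z t| ≤ M ∧ |R t| ≤ M := by
  obtain ⟨hp1, hp0⟩ := hpar.hurwitz_coeff_pos
  obtain ⟨hr2, hr1⟩ := hpar.frequency_coeff_nonneg
  -- constants of the normal form in the coordinates `(φ, z, η)`
  obtain ⟨b, hbdef⟩ : ∃ b, b = -(lpsi / 2 + α) := ⟨_, rfl⟩
  have hb : 0 < b := by
    rw [hbdef]
    exact pos_of_mul_pos_left (by linarith) hp1.le
  obtain ⟨k, hkdef⟩ : ∃ k, k = -lz / (2 * b) := ⟨_, rfl⟩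
  have hk : 0 < k := by rw [hkdef]; positivity
  have hbk : 2 * b * k = -lz := by rw [hkdef]; field_simp
  obtain ⟨c1, hc1def⟩ : ∃ c1, c1 = 2 * α - 9 / 8 := ⟨_, rfl⟩
  have hc1 : 0 ≤ c1 := by linarith
  obtain ⟨D, hDdef⟩ : ∃ D, D = 2 * α * (9 / 8) - (lphi - 3 / 4 * α) + k + 4 * α * b := ⟨_, rfl⟩
  have hD : D ≠ 0 := by
    rw [hDdef, hbdef]
    exact hpar.coupling_ne_zero (by rw [← hbdef]; exact hbk)
  have hDle : D ≤ 2 * b * c1 := by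
    have h : 0 ≤ b * (2 * b * c1 - D) := by
      have e : b * (2 * b * c1 - D)
          = b * (9 / 8 * lpsi + (lphi - 3 / 4 * α)) + lz / 2 := by
        have hl : lpsi = -2 * b - 2 * α := by linarith
        rw [hDdef, hc1def, hl]
        linear_combination (-1 / 2) * hbk
      rw [e, hbdef]; exact hr1
    linarith [nonneg_of_mul_nonneg_right h hb]
  set η : ℝ → ℝ := fun t => 2 * α * φ t - ψ t - k * z t with hη
  set w : ℝ → ℝ := fun t => -φ t * (φ t + 3 / 2) ^ 2 with hw
  set d : ℝ → ℝ := fun t => -3 * R t * (1 + φ t) with hd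
  have dφ : ∀ t ∈ J, HasDerivWithinAt φ
      (-c1 * φ t + k * z t + η t + w t / 2 + d t) J t := fun t ht =>
    (hmodel.deriv_phi t ht).congr_deriv (by simp only [hη, hw, hd, W, hc1def]; ring)
  have dψ : ∀ t ∈ J, HasDerivWithinAt ψ
      (lphi * φ t + lpsi * ψ t + lz * z t + α * W (φ t)) J t := fun t ht =>
    (hmodel.deriv_psi t ht).congr_deriv (by rw [hctrl.feedback t ht]; field_simp; ring)
  have dη : ∀ t ∈ J, HasDerivWithinAt η (D * φ t - 2 * b * η t + 2 * α * d t) J t := fun t ht => by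
    refine ((((dφ t ht).const_mul (2 * α)).sub (dψ t ht)).sub
      ((hctrl.deriv_z t ht).const_mul k)).congr_deriv ?_
    have hl : lpsi = -2 * b - 2 * α := by linarith
    simp only [hη, hw, hd, W, hc1def, hDdef, hl]
    linear_combination (-z t) * hbk
  have hRmem : ∀ t ∈ J, R t ∈ Icc 0 (R 0 + 2) := fun t ht =>
    stall_mem_Icc hσ hJ hJ0 hJpos (fun s hs => (hmodel.deriv_phi s hs).continuousWithinAt)
      hmodel.deriv_R hmodel.R_zero ht
  have hρ : 0 ≤ R 0 + 2 := by linarith [hmodel.R_zero]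
  obtain ⟨κ, K, δ, N, hN, hlow, hinit, hrate⟩ :=
    exists_invariant_level α (storage k (1 / |D|) (φ 0) (z 0) (η 0)) hb hk hc1 hD hDle hσ hρ
  -- the sublevel set is invariant
  have hlevel : ∀ t ∈ J, storage k (1 / |D|) (φ t) (z t) (η t) + K * R t
      + δ * crossTerm κ (φ t) (z t) (η t) ≤ N ^ 2 := fun t ht => by
    refine le_of_hasDerivWithinAt_lt hJ hJ0 hJpos
      (f := fun t => storage k (1 / |D|) (φ t) (z t) (η t) + K * R t
        + δ * crossTerm κ (φ t) (z t) (η t))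
      (fun s hs => ((hasDerivWithinAt_storage (1 / |D|) rfl rfl rfl (dφ s hs)
        (hctrl.deriv_z s hs) (dη s hs)).add ((hmodel.deriv_R s hs).const_mul K)).add
        ((hasDerivWithinAt_crossTerm κ rfl rfl rfl (dφ s hs)
        (hctrl.deriv_z s hs) (dη s hs)).const_mul δ))
      (fun s => hasDerivAt_const s (N ^ 2))
      (hinit _ _ _ _ (hRmem 0 hJ0).2 le_rfl) (fun s hs he => ?_) ht
    exact hrate _ _ _ _ _ _ (hRmem s hs).1 (hRmem s hs).2 he rfl rfl
  set B := (2 + 2 / k + 2 / (1 / |D|)) * N with hB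
  refine ⟨B + (2 * |α| * B + k * B + B) + (R 0 + 2), fun t ht => ?_⟩
  obtain ⟨h1, h2, h3⟩ := abs_le_of_storage_le hk (by positivity) hN
    (hlow _ _ _ _ (hRmem t ht).1 (hlevel t ht))
  rw [← hB] at h1 h2 h3
  have hB0 : 0 ≤ B := (abs_nonneg _).trans h1
  have hψ : |ψ t| ≤ 2 * |α| * B + k * B + B := by
    have e : ψ t = 2 * α * φ t + -(k * z t) + -η t := by simp only [hη]; ring
    rw [e]
    refine (abs_add_three _ _ _).trans ?_
    rw [abs_neg, abs_neg, abs_mul, abs_mul, abs_mul, abs_of_pos hk,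
      abs_of_pos (by norm_num : (0 : ℝ) < 2)]
    gcongr
  have h4 : 0 ≤ 2 * |α| * B + k * B + B := by positivity
  have h5 : |R t| ≤ R 0 + 2 := by rw [abs_of_nonneg (hRmem t ht).1]; exact (hRmem t ht).2
  exact ⟨by linarith, by linarith, by linarith, by linarith⟩
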